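/- Let $p$ be a prime and let $G$ be a finite non-abelian $p$-group with center $Z(G)$ such that $(G,Z(G))$ is a Camina pair, that is, $xZ(G)\subseteq x^G$ for every $x\in G\setminus Z(G)$, where $x^G$ denotes the conjugacy class of $x$ in $G$. Then $|G|$ divides $|\mathrm{Aut}(G)|$. -/

import Mathlib

/-- `(G, N)` is a Camina pair: for every `x ∈ G \ N`, the coset `xN` is contained in the conjugacy
class `x ^ G` of `x` in `G`. -/
def IsCaminaPair {G : Type*} [Group G] (N : Subgroup G) : Prop :=
  ∀ x : G, x ∉ N → ∀ z ∈ N, x * z ∈ conjugatesOf x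

/-! Since |G| = |Inn G||Z| with Z = Z(G), it suffices that |Z| divides |Out G|
(`card_dvd_card_mulAut`). Write an automorphism as g ↦ g * f g. If it is conjugation by a noncentral
a, then f g = [g⁻¹, a], and the Camina condition makes f attain every central value. So f missing
one central value forces a to be central and f trivial.

If |Z| > p, take L of index p in Z. Homomorphisms G → L missing Z \ L give at least |Z| classes in
Out G (`card_center_dvd_card_outer`). If |Z| = p, one noninner automorphism of p-power order is
enough. If all g ↦ g * z ^ φ g are inner, the inducing elements x serve to build a crossed
homomorphism whose only central value is 1. -/

section InnerAutomorphisms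

variable {G : Type*} [Group G]

instance innerAut_normal : (MulAut.conj : G →* MulAut G).range.Normal where
  conj_mem := by
    rintro _ ⟨g, rfl⟩ φ
    refine ⟨φ g, ?_⟩
    ext x
    simp

theorem conj_ker_eq_center : (MulAut.conj : G →* MulAut G).ker = Subgroup.center G := by
  ext g
  rw [MonoidHom.mem_ker, Subgroup.mem_center_iff]
  constructor
  · intro h x
    have := DFunLike.congr_fun h x
    simp only [MulAut.conj_apply, MulAut.one_apply] at this
    exact (mul_inv_eq_iff_eq_mul.1 this).symm
  · intro h
    ext x
    simp only [MulAut.conj_apply, MulAut.one_apply]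
    exact mul_inv_eq_iff_eq_mul.2 (h x).symm

/-- If the order of the center divides the order of the outer automorphism group, then the order
of the group divides that of the automorphism group. -/
theorem card_dvd_card_mulAut
    (h : Nat.card (Subgroup.center G) ∣
      Nat.card (MulAut G ⧸ (MulAut.conj : G →* MulAut G).range)) :
    Nat.card G ∣ Nat.card (MulAut G) := by
  rw [Subgroup.card_eq_card_quotient_mul_card_subgroup (MulAut.conj : G →* MulAut G).range,
    Subgroup.card_eq_card_quotient_mul_card_subgroup (Subgroup.center G), mul_comm,
    ← conj_ker_eq_center,
    Nat.card_congr (QuotientGroup.quotientKerEquivRange (MulAut.conj : G →* MulAut G)).toEquiv,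
    conj_ker_eq_center]
  exact Nat.mul_dvd_mul_right h _

/-- A noninner automorphism of `p`-power order makes the order of the outer automorphism group
divisible by `p`. -/
theorem prime_dvd_card_outer {p : ℕ} (hp : p.Prime) [Finite G] (α : MulAut G) {k : ℕ}
    (hα : α ^ p ^ k = 1) (hα' : α ∉ (MulAut.conj : G →* MulAut G).range) :
    p ∣ Nat.card (MulAut G ⧸ (MulAut.conj : G →* MulAut G).range) := by
  set q : MulAut G ⧸ (MulAut.conj : G →* MulAut G).range := QuotientGroup.mk α with hq
  have hq1 : q ≠ 1 := fun h => hα' ((QuotientGroup.eq_one_iff α).1 h)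
  have hqp : q ^ p ^ k = 1 := by rw [hq, ← QuotientGroup.mk_pow, hα, QuotientGroup.mk_one]
  obtain ⟨j, -, hj⟩ := (Nat.dvd_prime_pow hp).1 (orderOf_dvd_of_pow_eq_one hqp)
  have hj0 : j ≠ 0 := by
    rintro rfl
    exact hq1 (orderOf_eq_one_iff.1 (by simpa using hj))
  exact (dvd_pow_self p hj0).trans (hj ▸ orderOf_dvd_natCard q)

/-- The automorphism `g ↦ g * f g` attached to a crossed homomorphism `f` with `f ∘ f = 1`. -/
theorem exists_mulAut_of_crossedHom [Finite G] (f : G → G)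
    (hf : ∀ g h, f (g * h) = h⁻¹ * f g * h * f h) (hff : ∀ g, f (f g) = 1) :
    ∃ α : MulAut G, (∀ g, α g = g * f g) ∧ ∀ n : ℕ, (∀ g, f g ^ n = 1) → α ^ n = 1 := by
  let F : G →* G := MonoidHom.mk' (fun g => g * f g) (fun g h => by rw [hf]; group)
  have hF : ∀ g, F g = g * f g := fun _ => rfl
  have hinj : Function.Injective F := by
    rw [injective_iff_map_eq_one]
    intro g hg
    have h1 : g⁻¹ = f g := by
      rw [hF] at hg
      exact inv_eq_of_mul_eq_one_right hg
    have h2 : F g⁻¹ = g⁻¹ := by rw [hF, h1, hff, mul_one]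
    rw [map_inv, hg, inv_one] at h2
    exact (inv_eq_one.1 h2.symm)
  let α : MulAut G := MulEquiv.ofBijective F (Finite.injective_iff_bijective.1 hinj)
  have hα : ∀ g, α g = g * f g := fun _ => rfl
  have hpow : ∀ (n : ℕ) (g : G), (α ^ n) g = g * f g ^ n := by
    intro n
    induction n with
    | zero => intro g; simp
    | succ n ih =>
      intro g
      rw [pow_succ', MulAut.mul_apply, ih, map_mul, map_pow, hα, hα, hff, mul_one, mul_assoc,
        ← pow_succ']
  refine ⟨α, hα, fun n hn => ?_⟩
  ext g
  rw [hpow, hn, mul_one, MulAut.one_apply]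

end InnerAutomorphisms

section Camina

variable {G : Type*} [Group G]

theorem IsCaminaPair.exists_conj {N : Subgroup G} (h : IsCaminaPair N) {x z : G} (hx : x ∉ N)
    (hz : z ∈ N) : ∃ g, g⁻¹ * x * g = x * z := by
  obtain ⟨c, hc⟩ := isConj_iff.1 (h x hx z hz)
  exact ⟨c⁻¹, by rw [inv_inv, hc]⟩

/-- A nontrivial crossed homomorphism whose values avoid the nontrivial central elements is not
principal when `(G, Z(G))` is a Camina pair. -/
theorem prime_dvd_card_outer_of_crossedHom {p : ℕ} (hp : p.Prime) [Finite G]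
    (hcam : IsCaminaPair (Subgroup.center G)) {z : G} (hz : z ∈ Subgroup.center G) (hz1 : z ≠ 1)
    (f : G → G) (hf : ∀ g h, f (g * h) = h⁻¹ * f g * h * f h) (hff : ∀ g, f (f g) = 1) {k : ℕ}
    (hk : ∀ g, f g ^ p ^ k = 1) (hne : ∃ g, f g ≠ 1)
    (hcen : ∀ g, f g ∈ Subgroup.center G → f g = 1) :
    p ∣ Nat.card (MulAut G ⧸ (MulAut.conj : G →* MulAut G).range) := by
  obtain ⟨α, hα, hpow⟩ := exists_mulAut_of_crossedHom f hf hff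
  refine prime_dvd_card_outer hp α (hpow _ hk) ?_
  rintro ⟨a, rfl⟩
  have hfa : ∀ g, f g = g⁻¹ * a * g * a⁻¹ := by
    intro g
    have := hα g
    rw [MulAut.conj_apply] at this
    rw [← inv_mul_eq_iff_eq_mul] at this
    rw [← this]; group
  by_cases ha : a ∈ Subgroup.center G
  · obtain ⟨g, hg⟩ := hne
    apply hg
    rw [hfa, mul_assoc g⁻¹, ← Subgroup.mem_center_iff.1 ha g]
    group
  · obtain ⟨g, hg⟩ := hcam.exists_conj ha hz
    have hfg : f g = z := by
      rw [hfa, hg, Subgroup.mem_center_iff.1 hz a]; group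
    exact hz1 (hfg ▸ hcen g (hfg ▸ hz))

/-- Every homomorphism to a commutative group kills the center of a nonabelian group `G` for which
`(G, Z(G))` is a Camina pair. -/
theorem IsCaminaPair.map_center_eq_one (hcam : IsCaminaPair (Subgroup.center G))
    (hnt : ∃ x, x ∉ Subgroup.center G) {A : Type*} [CommGroup A] (f : G →* A) {z : G}
    (hz : z ∈ Subgroup.center G) : f z = 1 := by
  obtain ⟨x, hx⟩ := hnt
  obtain ⟨g, hg⟩ := hcam.exists_conj hx hz
  have := congrArg f hg
  simp only [map_mul, map_inv] at this
  rw [mul_right_comm, inv_mul_cancel, one_mul] at this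
  exact left_eq_mul.1 this

/-- For a noncentral x with x ^ p central, x * z is conjugate to x, so x ^ p = (x * z) ^ p = x ^ p *
z ^ p. -/
theorem IsCaminaPair.pow_eq_one_of_mem_center {p : ℕ}
    (hG : IsPGroup p G) (hcam : IsCaminaPair (Subgroup.center G))
    (hnt : ∃ x, x ∉ Subgroup.center G) {z : G} (hz : z ∈ Subgroup.center G) : z ^ p = 1 := by
  obtain ⟨y, hy⟩ := hnt
  obtain ⟨n, hn⟩ := hG y
  obtain ⟨x, hx, hxp⟩ : ∃ x, x ∉ Subgroup.center G ∧ x ^ p ∈ Subgroup.center G := by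
    by_contra! hcon
    have : ∀ k, y ^ p ^ k ∉ Subgroup.center G := by
      intro k
      induction k with
      | zero => simpa using hy
      | succ k ih => rw [pow_succ, pow_mul]; exact hcon _ ih
    exact this n (hn ▸ one_mem _)
  obtain ⟨g, hg⟩ := hcam.exists_conj hx hz
  have h1 : (g⁻¹ * x * g) ^ p = x ^ p := by
    have h2 : (g⁻¹ * x * g) ^ p = g⁻¹ * x ^ p * g := by
      have h3 := conj_pow (a := g⁻¹) (b := x) (i := p)
      rwa [inv_inv] at h3
    rw [h2, mul_assoc, ← Subgroup.mem_center_iff.1 hxp g, inv_mul_cancel_left]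
  have hc : Commute x z := Subgroup.mem_center_iff.1 hz x
  rw [hg, hc.mul_pow] at h1
  exact mul_eq_left.1 h1

end Camina

/-! ### Two independent homomorphisms to ℤ/p -/

section TwoHoms

/-- A finite noncyclic `p`-group has two independent homomorphisms onto `ℤ/p`. -/
theorem IsPGroup.exists_two_homs {p : ℕ} (hp : p.Prime) {G : Type*} [Group G] [Finite G]
    (hG : IsPGroup p G) (hnc : ¬ IsCyclic G) :
    ∃ φ₁ φ₂ : G →* Multiplicative (ZMod p), ∃ e₁ e₂ : G,
      φ₁ e₁ ≠ 1 ∧ φ₁ e₂ = 1 ∧ φ₂ e₁ = 1 ∧ φ₂ e₂ ≠ 1 := by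
  have : Fact p.Prime := ⟨hp⟩
  obtain ⟨n, hn⟩ := hG.exists_card_eq
  have hn0 : n ≠ 0 := by
    rintro rfl
    rw [pow_zero] at hn
    have := (Nat.card_eq_one_iff_unique.1 hn).1
    exact hnc inferInstance
  obtain ⟨m, rfl⟩ := Nat.exists_eq_succ_of_ne_zero hn0
  have hmax : ∀ H : Subgroup G, H ≠ ⊤ → ∃ K : Subgroup G, Nat.card K = p ^ m ∧ H ≤ K := by
    intro H hH
    obtain ⟨j, hj⟩ := (hG.to_subgroup H).exists_card_eq
    refine Sylow.exists_subgroup_card_pow_prime_le p (hn ▸ pow_dvd_pow p m.le_succ) H hj ?_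
    by_contra! hlt
    apply hH
    apply Subgroup.eq_top_of_le_card
    rw [hj, hn]
    exact Nat.pow_le_pow_right hp.pos hlt
  have hhom : ∀ K : Subgroup G, Nat.card K = p ^ m →
      ∃ φ : G →* Multiplicative (ZMod p), φ.ker = K := by
    intro K hK
    have hidx : K.index = p := by
      have := K.index_mul_card
      rw [hK, hn, pow_succ, mul_comm] at this
      exact Nat.eq_of_mul_eq_mul_left (pow_pos hp.pos m) this
    have hmin : (Nat.card G).minFac = p := by
      rw [hn, Nat.pow_minFac (Nat.succ_ne_zero m), hp.minFac_eq]
    have : K.Normal := Subgroup.normal_of_index_eq_minFac_card (hidx.trans hmin.symm)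
    have hcardq : Nat.card (G ⧸ K) = p := hidx
    have e : (G ⧸ K) ≃* Multiplicative (ZMod p) :=
      mulEquivOfPrimeCardEq (p := p) hcardq (by simp)
    refine ⟨e.toMonoidHom.comp (QuotientGroup.mk' K), ?_⟩
    ext x
    simp
  have hne_top : ∀ K : Subgroup G, Nat.card K = p ^ m → ∃ g, g ∉ K := by
    intro K hK
    by_contra! h
    have hKt : K = ⊤ := (Subgroup.eq_top_iff' K).2 h
    rw [hKt, Subgroup.card_top, hn] at hK
    have := Nat.pow_right_injective hp.two_le hK
    omega
  -- The trivial subgroup serves only to produce some maximal subgroup; the second one contains g ∉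
  -- M, hence differs.
  obtain ⟨M, hM, -⟩ := hmax (Subgroup.zpowers 1) (fun h =>
    hnc (isCyclic_iff_exists_zpowers_eq_top.2 ⟨1, h⟩))
  obtain ⟨g, hg⟩ := hne_top M hM
  obtain ⟨M', hM', hgM'⟩ := hmax (Subgroup.zpowers g) (fun h =>
    hnc (isCyclic_iff_exists_zpowers_eq_top.2 ⟨g, h⟩))
  have hgM'' : g ∈ M' := hgM' (Subgroup.mem_zpowers g)
  obtain ⟨e, heM, heM'⟩ : ∃ e ∈ M, e ∉ M' := by
    by_contra! h
    have := Subgroup.eq_of_le_of_card_ge (H := M) (K := M') h (by rw [hM, hM'])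
    exact hg (this ▸ hgM'')
  obtain ⟨φ₁, h₁⟩ := hhom M hM
  obtain ⟨φ₂, h₂⟩ := hhom M' hM'
  subst h₁ h₂
  exact ⟨φ₁, φ₂, g, e, hg, heM, hgM'', heM'⟩

end TwoHoms

section ResiduePowers

variable {p : ℕ} {G : Type*} [Group G] {x : G}

theorem pow_val_add [NeZero p] (hx : x ^ p = 1) (a b : ZMod p) :
    x ^ (a + b).val = x ^ a.val * x ^ b.val := by
  rw [ZMod.val_add, ← pow_add, ← pow_eq_pow_mod _ hx]

theorem pow_val_mul (hx : x ^ p = 1) (a b : ZMod p) :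
    x ^ (a * b).val = (x ^ a.val) ^ b.val := by
  rw [ZMod.val_mul, ← pow_mul, ← pow_eq_pow_mod _ hx]

theorem pow_val_eq_one_iff (hp : p.Prime) (hx : x ^ p = 1) (hx1 : x ≠ 1) (a : ZMod p) :
    x ^ a.val = 1 ↔ a = 0 := by
  have : Fact p.Prime := ⟨hp⟩
  rw [← orderOf_dvd_iff_pow_eq_one, orderOf_eq_prime hx hx1, Nat.dvd_iff_mod_eq_zero,
    Nat.mod_eq_of_lt a.val_lt, ZMod.val_eq_zero]

end ResiduePowers

/-! ### Crossed homomorphisms for a center of order p -/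

section CrossedHoms

variable {G : Type*} [Group G]

theorem conj_mul_of_mem_center {w : G} (hw : w ∈ Subgroup.center G) (h y : G) :
    h⁻¹ * (y * w) * h = h⁻¹ * y * h * w := by
  simp only [mul_assoc, Subgroup.mem_center_iff.1 hw h]

theorem inv_conj_pow (h y : G) (n : ℕ) : h⁻¹ * y ^ n * h = (h⁻¹ * y * h) ^ n := by
  have h3 := conj_pow (a := h⁻¹) (b := y) (i := n)
  rw [inv_inv] at h3
  exact h3.symm

variable {p : ℕ} {x z : G} {φ : G → ZMod p}

/-- If conjugation multiplies `x` by central powers `z ^ φ g`, then `φ` vanishes on everything that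
commutes with `x`. -/
theorem eq_zero_of_conj_eq (hp : p.Prime) (hzp : z ^ p = 1) (hz1 : z ≠ 1)
    (hx : ∀ g, g⁻¹ * x * g = x * z ^ (φ g).val) {y : G} (hy : Commute x y) : φ y = 0 := by
  rw [← pow_val_eq_one_iff hp hzp hz1, ← mul_right_inj x, ← hx, mul_assoc, hy.eq]
  group

theorem inv_conj_pow_val (hz : z ∈ Subgroup.center G) (hzp : z ^ p = 1)
    (hx : ∀ g, g⁻¹ * x * g = x * z ^ (φ g).val) (h : G) (i : ZMod p) :
    h⁻¹ * x ^ i.val * h = x ^ i.val * z ^ (φ h * i).val := by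
  have hc : Commute x (z ^ (φ h).val) := Subgroup.mem_center_iff.1 (pow_mem hz _) x
  rw [inv_conj_pow, hx, hc.mul_pow, pow_val_mul hzp]

theorem eq_zero_of_pow_val_mem_center (hp : p.Prime) (hz : z ∈ Subgroup.center G)
    (hzp : z ^ p = 1) (hz1 : z ≠ 1) (hx : ∀ g, g⁻¹ * x * g = x * z ^ (φ g).val)
    (hφ1 : ∃ g, φ g ≠ 0) {i : ZMod p} (hi : x ^ i.val ∈ Subgroup.center G) : i = 0 := by
  have : Fact p.Prime := ⟨hp⟩
  obtain ⟨g, hg⟩ := hφ1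
  have h1 := inv_conj_pow_val hz hzp hx g i
  rw [mul_assoc, ← Subgroup.mem_center_iff.1 hi g, inv_mul_cancel_left, left_eq_mul,
    pow_val_eq_one_iff hp hzp hz1] at h1
  exact (mul_eq_zero.1 h1).resolve_left hg

/-- Conjugating x ^ φ g by h contributes w ^ (2 φ g φ h), the cross term of (φ g + φ h)². Hence the
correction w ^ (φ g)², and the square w ^ 2 in `hx`. -/
theorem prime_dvd_card_outer_of_odd (hp : p.Prime) (hp2 : p ≠ 2) [Finite G]
    (hcam : IsCaminaPair (Subgroup.center G)) {w : G} (hw : w ∈ Subgroup.center G)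
    (hwp : w ^ p = 1) (hw1 : w ≠ 1) (hφ : ∀ g h, φ (g * h) = φ g + φ h)
    (hφ1 : ∃ g, φ g ≠ 0) (hxp : x ^ p = 1)
    (hx : ∀ g, g⁻¹ * x * g = x * (w ^ 2) ^ (φ g).val) :
    p ∣ Nat.card (MulAut G ⧸ (MulAut.conj : G →* MulAut G).range) := by
  have : Fact p.Prime := ⟨hp⟩
  have hz : w ^ 2 ∈ Subgroup.center G := pow_mem hw 2
  have hzp : (w ^ 2) ^ p = 1 := by rw [← pow_mul, mul_comm, pow_mul, hwp, one_pow]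
  have hz1 : w ^ 2 ≠ 1 := by
    intro h
    have h1 := orderOf_dvd_of_pow_eq_one h
    rw [orderOf_eq_prime hwp hw1] at h1
    exact hp2 ((Nat.prime_dvd_prime_iff_eq hp Nat.prime_two).1 h1)
  have hcomm : ∀ (y : G) (n : ℕ), Commute (w ^ n) y := fun y n =>
    (Subgroup.mem_center_iff.1 (pow_mem hw n) y).symm
  refine prime_dvd_card_outer_of_crossedHom hp hcam hw hw1
    (fun g => x ^ (φ g).val * w ^ (φ g * φ g).val) (k := 1) ?_ ?_ ?_ ?_ ?_
  · intro g h
    have h2 : (w ^ 2) ^ (φ h * φ g).val = w ^ (φ h * φ g + φ h * φ g).val := by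
      rw [← pow_mul, mul_comm, pow_mul, sq, ← pow_val_add hwp]
    rw [conj_mul_of_mem_center (pow_mem hw _), inv_conj_pow_val hz hzp hx, hφ, h2,
      show (φ g + φ h) * (φ g + φ h) =
        (φ h * φ g + φ h * φ g) + φ g * φ g + φ h * φ h by ring,
      pow_val_add hwp, pow_val_add hwp, pow_val_add hxp]
    have hc := hcomm (x ^ (φ h).val)
    simp only [mul_assoc]
    rw [← mul_assoc (w ^ (φ g * φ g).val) (x ^ _), (hc _).eq, mul_assoc,
      ← mul_assoc (w ^ (φ h * φ g + φ h * φ g).val) (x ^ _), (hc _).eq, mul_assoc]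
  · intro g
    have h0 : φ (x ^ (φ g).val * w ^ (φ g * φ g).val) = 0 :=
      eq_zero_of_conj_eq hp hzp hz1 hx
        (((Commute.refl x).pow_right _).mul_right (hcomm x _).symm)
    simp [h0]
  · intro g
    rw [pow_one, ((hcomm (x ^ (φ g).val) _).symm).mul_pow, ← pow_mul, ← pow_mul,
      mul_comm, pow_mul, hxp, one_pow, mul_comm, pow_mul, hwp, one_pow, one_mul]
  · obtain ⟨g, hg⟩ := hφ1
    refine ⟨g, fun h => hg ?_⟩
    refine eq_zero_of_pow_val_mem_center hp hz hzp hz1 hx ⟨g, hg⟩ (i := φ g) ?_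
    rw [eq_inv_of_mul_eq_one_left h]
    exact inv_mem (pow_mem hw _)
  · intro g hg
    have h0 : φ g = 0 := by
      refine eq_zero_of_pow_val_mem_center hp hz hzp hz1 hx hφ1 ?_
      exact (Subgroup.mul_mem_cancel_right _ (pow_mem hw _)).1 hg
    simp [h0]

/-- Here g ↦ x ^ φ g is already crossed: when φ g = φ h = 1, the carry x ^ 2 = z cancels the z
produced by conjugation. -/
theorem two_dvd_card_outer_of_sq_eq [Finite G] {φ : G → ZMod 2}
    (hcam : IsCaminaPair (Subgroup.center G)) (hz : z ∈ Subgroup.center G)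
    (hzp : z ^ 2 = 1) (hz1 : z ≠ 1) (hφ : ∀ g h, φ (g * h) = φ g + φ h)
    (hφ1 : ∃ g, φ g ≠ 0) (hxz : x ^ 2 = z)
    (hx : ∀ g, g⁻¹ * x * g = x * z ^ (φ g).val) :
    2 ∣ Nat.card (MulAut G ⧸ (MulAut.conj : G →* MulAut G).range) := by
  have hp := Nat.prime_two
  have h01 : ∀ a : ZMod 2, a = 0 ∨ a = 1 := by decide
  have hv1 : (1 : ZMod 2).val = 1 := rfl
  have hxc : ∀ g, φ g = 1 → x ^ (φ g).val ∉ Subgroup.center G := by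
    intro g hg hc
    rw [eq_zero_of_pow_val_mem_center hp hz hzp hz1 hx hφ1 hc] at hg
    exact zero_ne_one hg
  refine prime_dvd_card_outer_of_crossedHom hp hcam hz hz1
    (fun g => x ^ (φ g).val) (k := 2) ?_ ?_ ?_ ?_ ?_
  · intro g h
    rw [inv_conj_pow_val hz hzp hx, hφ]
    rcases h01 (φ g) with hg | hg <;> rcases h01 (φ h) with hh | hh
    · simp [hg, hh]
    · simp [hg, hh]
    · simp [hg, hh]
    · rw [hg, hh, show (1 : ZMod 2) + 1 = 0 from rfl, mul_one, hv1, pow_one, pow_one,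
        ZMod.val_zero, pow_zero, mul_assoc, ← Subgroup.mem_center_iff.1 hz x, ← mul_assoc, ← sq,
        hxz, ← sq, hzp]
  · intro g
    have h0 : φ (x ^ (φ g).val) = 0 :=
      eq_zero_of_conj_eq hp hzp hz1 hx ((Commute.refl x).pow_right _)
    simp [h0]
  · intro g
    rw [pow_right_comm, sq 2, pow_mul, hxz, hzp, one_pow]
  · obtain ⟨g, hg⟩ := hφ1
    refine ⟨g, fun h => hxc g ((h01 _).resolve_left hg) ?_⟩
    rw [h]
    exact one_mem _
  · intro g hg
    rcases h01 (φ g) with h | h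
    · simp [h]
    · exact absurd hg (hxc g h)

/-- Pairing x₂ with φ₁ and x₁ with φ₂ makes the conjugation terms the polarization of φ₁ φ₂, so no
division by 2 is needed. -/
theorem two_dvd_card_outer_of_sq_eq_one [Finite G] {φ₁ φ₂ : G → ZMod 2} {x₁ x₂ e₁ e₂ : G}
    (hcam : IsCaminaPair (Subgroup.center G)) (hz : z ∈ Subgroup.center G)
    (hzp : z ^ 2 = 1) (hz1 : z ≠ 1) (hφ₁ : ∀ g h, φ₁ (g * h) = φ₁ g + φ₁ h)
    (hφ₂ : ∀ g h, φ₂ (g * h) = φ₂ g + φ₂ h)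
    (h₁₁ : φ₁ e₁ ≠ 0) (h₁₂ : φ₁ e₂ = 0) (h₂₁ : φ₂ e₁ = 0) (h₂₂ : φ₂ e₂ ≠ 0)
    (hs₁ : x₁ ^ 2 = 1) (hs₂ : x₂ ^ 2 = 1) (hcomm : Commute x₁ x₂)
    (hx₁ : ∀ g, g⁻¹ * x₁ * g = x₁ * z ^ (φ₁ g).val)
    (hx₂ : ∀ g, g⁻¹ * x₂ * g = x₂ * z ^ (φ₂ g).val) :
    2 ∣ Nat.card (MulAut G ⧸ (MulAut.conj : G →* MulAut G).range) := by
  have hp := Nat.prime_two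
  have hzc : ∀ (y : G) (n : ℕ), Commute (z ^ n) y := fun y n =>
    (Subgroup.mem_center_iff.1 (pow_mem hz n) y).symm
  have hcen : ∀ i j k : ZMod 2, x₂ ^ i.val * x₁ ^ j.val * z ^ k.val ∈ Subgroup.center G →
      i = 0 ∧ j = 0 := by
    intro i j k h
    have h' := (Subgroup.mul_mem_cancel_right _ (pow_mem hz _)).1 h
    have key : ∀ g, φ₂ g * i + φ₁ g * j = 0 := by
      intro g
      have h1 : g⁻¹ * (x₂ ^ i.val * x₁ ^ j.val) * g =
          (g⁻¹ * x₂ ^ i.val * g) * (g⁻¹ * x₁ ^ j.val * g) := by group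
      rw [inv_conj_pow_val hz hzp hx₂, inv_conj_pow_val hz hzp hx₁, mul_assoc g⁻¹,
        ← Subgroup.mem_center_iff.1 h' g, inv_mul_cancel_left, mul_assoc (x₂ ^ _),
        ← mul_assoc (z ^ _), (hzc (x₁ ^ j.val) _).eq, mul_assoc (x₁ ^ _), ← mul_assoc,
        left_eq_mul, ← pow_val_add hzp, pow_val_eq_one_iff hp hzp hz1] at h1
      exact h1
    have k1 := key e₁
    have k2 := key e₂
    rw [h₂₁, zero_mul, zero_add] at k1
    rw [h₁₂, zero_mul, add_zero] at k2
    exact ⟨(mul_eq_zero.1 k2).resolve_left h₂₂, (mul_eq_zero.1 k1).resolve_left h₁₁⟩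
  refine prime_dvd_card_outer_of_crossedHom hp hcam hz hz1
    (fun g => x₂ ^ (φ₁ g).val * x₁ ^ (φ₂ g).val * z ^ (φ₁ g * φ₂ g).val) (k := 1) ?_ ?_ ?_ ?_ ?_
  · intro g h
    have h1 : h⁻¹ * (x₂ ^ (φ₁ g).val * x₁ ^ (φ₂ g).val) * h =
        (h⁻¹ * x₂ ^ (φ₁ g).val * h) * (h⁻¹ * x₁ ^ (φ₂ g).val * h) := by group
    rw [conj_mul_of_mem_center (pow_mem hz _), h1, inv_conj_pow_val hz hzp hx₂,
      inv_conj_pow_val hz hzp hx₁, hφ₁, hφ₂,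
      show (φ₁ g + φ₁ h) * (φ₂ g + φ₂ h) =
        φ₂ h * φ₁ g + φ₁ h * φ₂ g + φ₁ g * φ₂ g + φ₁ h * φ₂ h by ring,
      pow_val_add hzp, pow_val_add hzp, pow_val_add hzp, pow_val_add hs₁, pow_val_add hs₂]
    have c1 := (hcomm.pow_pow (φ₂ g).val (φ₁ h).val).eq
    generalize x₂ ^ (φ₁ g).val = a at *
    generalize x₂ ^ (φ₁ h).val = b at *
    generalize x₁ ^ (φ₂ g).val = c at *
    generalize x₁ ^ (φ₂ h).val = d at *
    have m1 := fun y => (hzc y (φ₂ h * φ₁ g).val).eq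
    have m2 := fun y => (hzc y (φ₁ h * φ₂ g).val).eq
    have m3 := fun y => (hzc y (φ₁ g * φ₂ g).val).eq
    have m4 := fun y => (hzc y (φ₁ h * φ₂ h).val).eq
    generalize z ^ (φ₂ h * φ₁ g).val = t1 at *
    generalize z ^ (φ₁ h * φ₂ g).val = t2 at *
    generalize z ^ (φ₁ g * φ₂ g).val = t3 at *
    generalize z ^ (φ₁ h * φ₂ h).val = t4 at *
    calc a * b * (c * d) * (t1 * t2 * t3 * t4)
        = a * (b * c) * d * (t1 * t2 * t3) * t4 := by group
      _ = a * c * b * d * (t1 * t2 * t3) * t4 := by rw [← c1]; group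
      _ = a * c * (b * d * t1) * (t2 * t3) * t4 := by group
      _ = a * (c * t1 * (b * d)) * (t2 * t3) * t4 := by rw [← m1]; group
      _ = a * t1 * c * (b * d * t2) * t3 * t4 := by rw [← m1 c]; group
      _ = a * t1 * c * t2 * (b * d * t3) * t4 := by rw [← m2]; group
      _ = a * t1 * (c * t2) * t3 * (b * d * t4) := by rw [← m3]; group
  · intro g
    have c1 : Commute x₁ (x₂ ^ (φ₁ g).val * x₁ ^ (φ₂ g).val * z ^ (φ₁ g * φ₂ g).val) :=
      ((hcomm.pow_right _).mul_right ((Commute.refl x₁).pow_right _)).mul_right (hzc x₁ _).symm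
    have c2 : Commute x₂ (x₂ ^ (φ₁ g).val * x₁ ^ (φ₂ g).val * z ^ (φ₁ g * φ₂ g).val) :=
      (((Commute.refl x₂).pow_right _).mul_right (hcomm.symm.pow_right _)).mul_right
        (hzc x₂ _).symm
    simp [eq_zero_of_conj_eq hp hzp hz1 hx₁ c1, eq_zero_of_conj_eq hp hzp hz1 hx₂ c2]
  · intro g
    rw [pow_one, ((hzc _ _).symm).mul_pow, (hcomm.symm.pow_pow _ _).mul_pow,
      pow_right_comm x₂, pow_right_comm x₁, pow_right_comm z, hs₁, hs₂, hzp]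
    simp
  · refine ⟨e₁, fun h => h₁₁ (hcen (φ₁ e₁) (φ₂ e₁) (φ₁ e₁ * φ₂ e₁) ?_).1⟩
    rw [h]
    exact one_mem _
  · intro g hg
    obtain ⟨h1, h2⟩ := hcen _ _ _ hg
    simp [h1, h2]

end CrossedHoms

/-! ### Central automorphisms -/

section CentralAutomorphisms

open scoped IsMulCommutative

variable {G : Type*} [Group G]

/-- The central automorphisms `g ↦ g * f g` attached to the homomorphisms `f : G → Z(G)`, when these
are all trivial on the center. -/
def centralAut (h0 : ∀ (f : G →* Subgroup.center G), ∀ z ∈ Subgroup.center G, f z = 1) :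
    (G →* Subgroup.center G) →* MulAut G where
  toFun f :=
    { toFun := fun g => g * f g
      invFun := fun g => g * (f g)⁻¹
      left_inv := fun g => by simp [h0 f _ (f g).2]
      right_inv := fun g => by simp [h0 f _ (f g).2]
      map_mul' := fun g h => by
        have := Subgroup.mem_center_iff.1 (f g).2 h
        rw [map_mul, Subgroup.coe_mul]
        simp only [mul_assoc]
        rw [← mul_assoc h, this, mul_assoc] }
  map_one' := by ext g; simp
  map_mul' f₁ f₂ := by
    ext g
    have := (Subgroup.mem_center_iff.1 (f₁ g).2 (f₂ g)).symm
    simp [h0 f₁ _ (f₂ g).2, mul_assoc, this]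

/-- The homomorphism `g ↦ u ^ φ₁ g * v ^ φ₂ g` as a function of `(u, v)`. -/
def twoParamHom {A : Type*} [CommGroup A] {p : ℕ} [NeZero p] (hA : ∀ a : A, a ^ p = 1)
    {φ₁ φ₂ : G → ZMod p} (hφ₁ : ∀ g h, φ₁ (g * h) = φ₁ g + φ₁ h)
    (hφ₂ : ∀ g h, φ₂ (g * h) = φ₂ g + φ₂ h) (L : Subgroup A) :
    L × L →* (G →* A) where
  toFun u := MonoidHom.mk' (fun g => (u.1 : A) ^ (φ₁ g).val * (u.2 : A) ^ (φ₂ g).val)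
    fun g h => by
      rw [hφ₁, hφ₂, pow_val_add (hA _), pow_val_add (hA _), mul_mul_mul_comm]
  map_one' := by ext g; simp
  map_mul' u v := by
    ext g
    simp [mul_pow, mul_mul_mul_comm]

theorem IsCaminaPair.card_center_dvd_card_outer {p : ℕ} (hp : p.Prime) [Finite G]
    (hcam : IsCaminaPair (Subgroup.center G)) (hnt : ∃ x, x ∉ Subgroup.center G)
    (hexp : ∀ z ∈ Subgroup.center G, z ^ p = 1)
    {φ₁ φ₂ : G → ZMod p} {e₁ e₂ : G} (hφ₁ : ∀ g h, φ₁ (g * h) = φ₁ g + φ₁ h)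
    (hφ₂ : ∀ g h, φ₂ (g * h) = φ₂ g + φ₂ h)
    (h₁₁ : φ₁ e₁ ≠ 0) (h₁₂ : φ₁ e₂ = 0) (h₂₁ : φ₂ e₁ = 0) (h₂₂ : φ₂ e₂ ≠ 0) {m : ℕ}
    (hm : Nat.card (Subgroup.center G) = p ^ (m + 2)) :
    Nat.card (Subgroup.center G) ∣
      Nat.card (MulAut G ⧸ (MulAut.conj : G →* MulAut G).range) := by
  have : Fact p.Prime := ⟨hp⟩
  have hA : ∀ a : Subgroup.center G, a ^ p = 1 := fun a => Subtype.ext (hexp a a.2)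
  have h0 : ∀ (f : G →* Subgroup.center G), ∀ z ∈ Subgroup.center G, f z = 1 :=
    fun f z hz => hcam.map_center_eq_one hnt f hz
  obtain ⟨L, hL⟩ := Sylow.exists_subgroup_card_pow_prime (G := Subgroup.center G) p (n := m + 1)
    (hm ▸ pow_dvd_pow p (Nat.le_succ _))
  obtain ⟨w, hw⟩ : ∃ w : Subgroup.center G, w ∉ L := by
    by_contra! h
    have hLt : L = ⊤ := (Subgroup.eq_top_iff' L).2 h
    rw [hLt, Subgroup.card_top, hm] at hL
    have := Nat.pow_right_injective hp.two_le hL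
    omega
  let Ψ : L × L →* MulAut G ⧸ (MulAut.conj : G →* MulAut G).range :=
    (QuotientGroup.mk' _).comp ((centralAut h0).comp (twoParamHom hA hφ₁ hφ₂ L))
  have hΨ : Function.Injective Ψ := by
    rw [injective_iff_map_eq_one]
    rintro ⟨u, v⟩ huv
    obtain ⟨a, ha⟩ := (QuotientGroup.eq_one_iff _).1 huv
    set f := twoParamHom hA hφ₁ hφ₂ L (u, v) with hf
    have hfg : ∀ g, f g =
        (u : Subgroup.center G) ^ (φ₁ g).val * (v : Subgroup.center G) ^ (φ₂ g).val :=
      fun _ => rfl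
    have hfa : ∀ g, (f g : G) = g⁻¹ * a * g * a⁻¹ := by
      intro g
      have h1 := DFunLike.congr_fun ha g
      change a * g * a⁻¹ = g * f g at h1
      rw [← inv_mul_eq_iff_eq_mul] at h1
      rw [← h1]; group
    have haZ : a ∈ Subgroup.center G := by
      by_contra haZ
      obtain ⟨g, hg⟩ := hcam.exists_conj haZ w.2
      have h2 : f g = w := by
        apply Subtype.ext
        rw [hfa, hg, Subgroup.mem_center_iff.1 w.2 a]; group
      exact hw (h2 ▸ hfg g ▸ mul_mem (pow_mem u.2 _) (pow_mem v.2 _))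
    have hf1 : ∀ g, f g = 1 := by
      intro g
      apply Subtype.ext
      rw [hfa, mul_assoc g⁻¹, ← Subgroup.mem_center_iff.1 haZ g, Subgroup.coe_one]; group
    have hu : (u : Subgroup.center G) = 1 := by
      by_contra hu
      have h3 := hf1 e₁
      rw [hfg, h₂₁, ZMod.val_zero, pow_zero, mul_one, pow_val_eq_one_iff hp (hA _) hu] at h3
      exact h₁₁ h3
    have hv : (v : Subgroup.center G) = 1 := by
      by_contra hv
      have h3 := hf1 e₂
      rw [hfg, h₁₂, ZMod.val_zero, pow_zero, one_mul, pow_val_eq_one_iff hp (hA _) hv] at h3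
      exact h₂₂ h3
    exact Prod.ext (Subtype.ext hu) (Subtype.ext hv)
  refine dvd_trans ?_ (Subgroup.card_dvd_of_injective Ψ hΨ)
  rw [Nat.card_prod, hL, hm, ← pow_add]
  -- |L|² = p ^ (2m + 2), and m + 2 ≤ 2m + 2.
  exact pow_dvd_pow p (by omega)

/-- Either the central automorphism `g ↦ g * z ^ φ g` is noninner, or it is induced by an
element. -/
theorem dvd_card_outer_or_exists_conj_eq {p : ℕ} (hp : p.Prime) [Finite G]
    (hcam : IsCaminaPair (Subgroup.center G)) (hnt : ∃ x, x ∉ Subgroup.center G)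
    {z : G} (hz : z ∈ Subgroup.center G) (hzp : z ^ p = 1) {φ : G → ZMod p}
    (hφ : ∀ g h, φ (g * h) = φ g + φ h) :
    p ∣ Nat.card (MulAut G ⧸ (MulAut.conj : G →* MulAut G).range) ∨
      ∃ x, ∀ g, g⁻¹ * x * g = x * z ^ (φ g).val := by
  have : Fact p.Prime := ⟨hp⟩
  have hφz : ∀ n : ℕ, φ (z ^ n) = 0 := by
    intro n
    let f : G →* Multiplicative (ZMod p) :=
      MonoidHom.mk' (fun g => Multiplicative.ofAdd (φ g)) fun g h => by rw [hφ, ofAdd_add]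
    exact hcam.map_center_eq_one hnt f (pow_mem hz n)
  obtain ⟨α, hα, hpow⟩ := exists_mulAut_of_crossedHom (fun g => z ^ (φ g).val)
    (fun g h => by
      rw [mul_assoc h⁻¹, ← Subgroup.mem_center_iff.1 (pow_mem hz _) h, inv_mul_cancel_left, hφ,
        pow_val_add hzp])
    (fun g => by simp [hφz])
  by_cases hin : α ∈ (MulAut.conj : G →* MulAut G).range
  · obtain ⟨a, rfl⟩ := hin
    refine Or.inr ⟨a, fun g => ?_⟩
    have := hα g
    rw [MulAut.conj_apply, mul_assoc, ← inv_mul_eq_iff_eq_mul] at this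
    rw [Subgroup.mem_center_iff.1 (pow_mem hz _) a, ← this]
    group
  · refine Or.inl (prime_dvd_card_outer hp α (k := 1) (hpow _ fun g => ?_) hin)
    rw [pow_one, pow_right_comm, hzp, one_pow]

end CentralAutomorphisms

/-! ### Center of order p -/

section CyclicCenter

variable {G : Type*} [Group G]

theorem mul_pow_of_commutator_mem_center {x y c : G} (hc : c ∈ Subgroup.center G)
    (h : y * x = x * y * c) (n : ℕ) : (x * y) ^ n = x ^ n * y ^ n * c ^ n.choose 2 := by
  have hcc : ∀ (g : G) (k : ℕ), c ^ k * g = g * c ^ k := fun g k =>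
    (Subgroup.mem_center_iff.1 (pow_mem hc k) g).symm
  have hyn : ∀ n : ℕ, y ^ n * x = x * y ^ n * c ^ n := by
    intro n
    induction n with
    | zero => simp
    | succ n ih =>
      rw [pow_succ', mul_assoc, ih, ← mul_assoc, ← mul_assoc, h, mul_assoc _ c, ← pow_one c, hcc,
        pow_one, ← mul_assoc, mul_assoc _ c, ← pow_succ', mul_assoc x y]
  induction n with
  | zero => simp
  | succ n ih =>
    have hch : (n + 1).choose 2 = n + n.choose 2 := by
      rw [Nat.choose_succ_succ' n 1, Nat.choose_one_right]
    rw [pow_succ, ih, mul_assoc, hcc, ← mul_assoc, ← mul_assoc, mul_assoc _ (y ^ n) x, hyn,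
      ← mul_assoc, ← mul_assoc, mul_assoc _ (c ^ n) y, hcc, hch, pow_add c, pow_succ x, pow_succ y]
    simp only [mul_assoc]

theorem pow_prime_mem_center {p : ℕ} {x z : G} (hz : z ∈ Subgroup.center G) (hzp : z ^ p = 1)
    {φ : G → ZMod p} (hx : ∀ g, g⁻¹ * x * g = x * z ^ (φ g).val) : x ^ p ∈ Subgroup.center G := by
  rw [Subgroup.mem_center_iff]
  intro g
  have hc : Commute x (z ^ (φ g).val) := Subgroup.mem_center_iff.1 (pow_mem hz _) x
  have h1 := inv_conj_pow g x p
  rw [hx, hc.mul_pow, pow_right_comm z, hzp, one_pow, mul_one, mul_assoc,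
    inv_mul_eq_iff_eq_mul] at h1
  exact h1.symm

theorem IsCaminaPair.prime_dvd_card_outer_of_card_center {p : ℕ} (hp : p.Prime) [Finite G]
    (hcam : IsCaminaPair (Subgroup.center G)) (hnt : ∃ x, x ∉ Subgroup.center G)
    {φ₁ φ₂ : G → ZMod p} {e₁ e₂ : G} (hφ₁ : ∀ g h, φ₁ (g * h) = φ₁ g + φ₁ h)
    (hφ₂ : ∀ g h, φ₂ (g * h) = φ₂ g + φ₂ h)
    (h₁₁ : φ₁ e₁ ≠ 0) (h₁₂ : φ₁ e₂ = 0) (h₂₁ : φ₂ e₁ = 0) (h₂₂ : φ₂ e₂ ≠ 0)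
    (hcard : Nat.card (Subgroup.center G) = p) :
    p ∣ Nat.card (MulAut G ⧸ (MulAut.conj : G →* MulAut G).range) := by
  have : Fact p.Prime := ⟨hp⟩
  have hexp : ∀ z ∈ Subgroup.center G, z ^ p = 1 := fun z hz => by
    have := pow_card_eq_one' (x := (⟨z, hz⟩ : Subgroup.center G))
    rw [hcard] at this
    exact congrArg Subtype.val this
  have hpowers : ∀ w ∈ Subgroup.center G, w ≠ 1 → ∀ y ∈ Subgroup.center G, ∃ k : ℕ, w ^ k = y := by
    intro w hw hw1 y hy
    have hw1' : (⟨w, hw⟩ : Subgroup.center G) ≠ 1 := fun h => hw1 (congrArg Subtype.val h)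
    obtain ⟨k, hk⟩ := mem_powers_of_prime_card hcard hw1' (g' := ⟨y, hy⟩)
    exact ⟨k, congrArg Subtype.val hk⟩
  obtain ⟨w, hw, hw1⟩ : ∃ w ∈ Subgroup.center G, w ≠ 1 := by
    have : Nontrivial (Subgroup.center G) :=
      Finite.one_lt_card_iff_nontrivial.1 (hcard ▸ hp.one_lt)
    exact Subgroup.exists_ne_one_of_nontrivial _
  have hwp := hexp w hw
  by_contra hout
  have hind : ∀ z ∈ Subgroup.center G, ∀ φ : G → ZMod p, (∀ g h, φ (g * h) = φ g + φ h) →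
      ∃ x, ∀ g, g⁻¹ * x * g = x * z ^ (φ g).val := fun z hz φ hφ =>
    (dvd_card_outer_or_exists_conj_eq hp hcam hnt hz (hexp z hz) hφ).resolve_left hout
  rcases eq_or_ne p 2 with rfl | hp2
  · obtain ⟨x₁, hx₁⟩ := hind w hw φ₁ hφ₁
    obtain ⟨x₂, hx₂⟩ := hind w hw φ₂ hφ₂
    have hcase : ∀ y ∈ Subgroup.center G, y = 1 ∨ y = w := by
      intro y hy
      obtain ⟨k, rfl⟩ := hpowers w hw hw1 y hy
      rw [pow_eq_pow_mod k hwp]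
      rcases Nat.mod_two_eq_zero_or_one k with h | h <;> simp [h]
    have hsq : ∀ (φ : G → ZMod 2) (x : G), (∀ g h, φ (g * h) = φ g + φ h) → (∃ g, φ g ≠ 0) →
        (∀ g, g⁻¹ * x * g = x * w ^ (φ g).val) → x ^ 2 = 1 := by
      intro φ x hφ hφ1 hx
      refine (hcase _ (pow_prime_mem_center hw hwp hx)).resolve_right fun h => ?_
      exact hout (two_dvd_card_outer_of_sq_eq hcam hw hwp hw1 hφ hφ1 h hx)
    have hs₁ := hsq φ₁ x₁ hφ₁ ⟨e₁, h₁₁⟩ hx₁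
    have hs₂ := hsq φ₂ x₂ hφ₂ ⟨e₂, h₂₂⟩ hx₂
    -- The product induces φ₁ + φ₂, so its square is trivial too, which forces x₁ and x₂ to commute.
    have hs₁₂ : (x₁ * x₂) ^ 2 = 1 := by
      refine hsq (fun g => φ₁ g + φ₂ g) _ (fun g h => by rw [hφ₁, hφ₂]; ring) ⟨e₁, ?_⟩ ?_
      · simpa [h₂₁] using h₁₁
      · intro g
        have hg : g⁻¹ * (x₁ * x₂) * g = (g⁻¹ * x₁ * g) * (g⁻¹ * x₂ * g) := by group
        rw [hg, hx₁, hx₂, pow_val_add hwp, mul_assoc x₁, ← mul_assoc (w ^ _) x₂,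
          ← Subgroup.mem_center_iff.1 (pow_mem hw _) x₂]
        simp only [mul_assoc]
    refine hout (two_dvd_card_outer_of_sq_eq_one hcam hw hwp hw1 hφ₁ hφ₂ h₁₁ h₁₂ h₂₁ h₂₂ hs₁ hs₂
      ?_ hx₁ hx₂)
    have i₁ : x₁⁻¹ = x₁ := inv_eq_of_mul_eq_one_right (sq x₁ ▸ hs₁)
    have i₂ : x₂⁻¹ = x₂ := inv_eq_of_mul_eq_one_right (sq x₂ ▸ hs₂)
    have i₃ : (x₁ * x₂)⁻¹ = x₁ * x₂ := inv_eq_of_mul_eq_one_right (sq (x₁ * x₂) ▸ hs₁₂)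
    rw [mul_inv_rev, i₁, i₂] at i₃
    exact i₃.symm
  · have hz : w ^ 2 ∈ Subgroup.center G := pow_mem hw 2
    have hzp := hexp _ hz
    obtain ⟨x₁, hx₁⟩ := hind _ hz φ₁ hφ₁
    obtain ⟨x₂, hx₂⟩ := hind _ hz φ₂ hφ₂
    have hc₁ := pow_prime_mem_center hz hzp hx₁
    have hc₂ := pow_prime_mem_center hz hzp hx₂
    by_cases h1 : x₁ ^ p = 1
    · exact hout (prime_dvd_card_outer_of_odd hp hp2 hcam hw hwp hw1 hφ₁ ⟨e₁, h₁₁⟩ h1 hx₁)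
    -- x₁ ^ p generates the center, so k can be chosen to cancel x₂ ^ p in (x₂ * x₁ ^ k) ^ p.
    · obtain ⟨k, hk⟩ := hpowers _ hc₁ h1 _ (inv_mem hc₂)
      refine hout (prime_dvd_card_outer_of_odd hp hp2 hcam hw hwp hw1 (x := x₂ * x₁ ^ k)
        (φ := fun g => φ₂ g + φ₁ g * k) (fun g h => by rw [hφ₁, hφ₂]; ring)
        ⟨e₂, by simpa [h₁₂] using h₂₂⟩ ?_ ?_)
      · have hcomm : x₁ ^ k * x₂ =
            x₂ * x₁ ^ k * (w ^ 2) ^ (φ₁ x₂ * k).val := by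
          have h3 := inv_conj_pow x₂ x₁ k
          have hc : Commute x₁ ((w ^ 2) ^ (φ₁ x₂).val) :=
            Subgroup.mem_center_iff.1 (pow_mem hz _) x₁
          rw [hx₁, hc.mul_pow, mul_assoc, inv_mul_eq_iff_eq_mul] at h3
          rw [h3, pow_val_mul hzp, ZMod.val_natCast, mul_assoc,
            ← pow_eq_pow_mod k (hexp _ (pow_mem hz _))]
        rw [mul_pow_of_commutator_mem_center (pow_mem hz _) hcomm, pow_right_comm x₁, hk,
          mul_inv_cancel, one_mul, pow_right_comm, Nat.choose_two_right]
        -- For odd p, p divides the binomial coefficient, so the commutator factor dies.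
        obtain ⟨j, hj⟩ := hp.even_sub_one hp2
        have : p * (p - 1) / 2 = p * j := by
          rw [hj, ← two_mul, mul_left_comm, Nat.mul_div_cancel_left _ two_pos]
        rw [this, pow_mul, hzp, one_pow, one_pow]
      · intro g
        have hg : g⁻¹ * (x₂ * x₁ ^ k) * g = (g⁻¹ * x₂ * g) * (g⁻¹ * x₁ ^ k * g) := by group
        have hc : Commute x₁ ((w ^ 2) ^ (φ₁ g).val) :=
          Subgroup.mem_center_iff.1 (pow_mem hz _) x₁
        rw [hg, inv_conj_pow, hx₁, hx₂, hc.mul_pow, pow_val_add hzp, pow_val_mul hzp,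
          ZMod.val_natCast, ← pow_eq_pow_mod k (hexp _ (pow_mem hz _)), mul_assoc x₂,
          ← mul_assoc _ (x₁ ^ k), ← Subgroup.mem_center_iff.1 (pow_mem hz _) (x₁ ^ k)]
        simp only [mul_assoc]

end CyclicCenter

theorem theorem2p2 {p : ℕ} (hp : p.Prime) {G : Type*} [Group G] [Finite G]
    (hG : IsPGroup p G) (hnonab : ∃ a b : G, a * b ≠ b * a)
    (hcam : IsCaminaPair (Subgroup.center G)) :
    Nat.card G ∣ Nat.card (MulAut G) := by
  have : Fact p.Prime := ⟨hp⟩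
  obtain ⟨a, b, hab⟩ := hnonab
  have hnt : ∃ x, x ∉ Subgroup.center G :=
    ⟨b, fun h => hab (Subgroup.mem_center_iff.1 h a)⟩
  have hnc : ¬ IsCyclic G := fun h => by
    obtain ⟨g, hg⟩ := h.exists_generator
    obtain ⟨i, rfl⟩ := hg a
    obtain ⟨j, rfl⟩ := hg b
    exact hab ((Commute.refl g).zpow_zpow i j)
  have : Nontrivial G := ⟨⟨a * b, b * a, hab⟩⟩
  obtain ⟨Φ₁, Φ₂, e₁, e₂, h₁₁, h₁₂, h₂₁, h₂₂⟩ := hG.exists_two_homs hp hnc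
  have hΦ₁ : ∀ g h, (Φ₁ (g * h)).toAdd = (Φ₁ g).toAdd + (Φ₁ h).toAdd := fun g h => by
    rw [map_mul, toAdd_mul]
  have hΦ₂ : ∀ g h, (Φ₂ (g * h)).toAdd = (Φ₂ g).toAdd + (Φ₂ h).toAdd := fun g h => by
    rw [map_mul, toAdd_mul]
  apply card_dvd_card_mulAut
  have := hG.center_nontrivial
  obtain ⟨m, hm0, hm⟩ := (hG.to_subgroup (Subgroup.center G)).nontrivial_iff_card.1 this
  obtain _ | _ | m := m
  · exact absurd hm0 (lt_irrefl 0)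
  · rw [zero_add, pow_one] at hm
    rw [hm]
    exact hcam.prime_dvd_card_outer_of_card_center hp hnt hΦ₁ hΦ₂ h₁₁ h₁₂ h₂₁ h₂₂ hm
  · exact hcam.card_center_dvd_card_outer hp hnt
      (fun z hz => hcam.pow_eq_one_of_mem_center hG hnt hz) hΦ₁ hΦ₂ h₁₁ h₁₂ h₂₁ h₂₂ hm
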